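/- Let $\Lambda=\Lambda_0\oplus\Lambda_1$ be a finite-dimensional real associative unital $\mathbb Z/2$-graded algebra that is supercommutative, i.e. $ab=(-1)^{\sigma(a)\sigma(b)}ba$ for homogeneous $a,b$ of parities $\sigma(a),\sigma(b)$. Let $n,m\ge 0$ be integers. $(A_0)$ Let $(e_0=1,e_1,\dots,e_p)$ be a basis of $\Lambda_0$ with $\sum_{k=0}^p e_k^2=0$. $(A_1)$ Let $(\varepsilon_1,\dots,\varepsilon_q)$ be a basis of $\Lambda_1$, $1=s_1<s_2<\dots<s_r<s_{r+1}=q+1$ integers and $a_1,\dots,a_q\in\Lambda_0$ with $\varepsilon_j=a_j\varepsilon_{s_k}$ for $s_k\le j<s_{k+1}$, $a_{s_k}=1$ and $\sum_{j=s_k}^{s_{k+1}-1}a_j^2=0$ for $k=1,\dots,r$. (This condition is needed only if $m\ge 1$.) Write $x=(y_1,\dots,y_n,\theta_1,\dots,\theta_m)\in\Lambda_0^n\times\Lambda_1^m$ with $y_i=\sum_{j=0}^p y_i^je_j$, $\theta_l=\sum_{t=1}^q\theta_l^t\varepsilon_t$, and let $\|x\|^2=\sum_{i,j}(y_i^j)^2+\sum_{l,t}(\theta_l^t)^2$.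 Put $N=n(p+1)+qm$ and assume $N\ge 1$. Let $dV=dy_1^0\wedge\dots\wedge dy_1^p\wedge\dots\wedge dy_n^0\wedge\dots\wedge dy_n^p\wedge d\theta_1^1\wedge\dots\wedge d\theta_1^q\wedge\dots\wedge d\theta_m^1\wedge\dots\wedge d\theta_m^q$ define the orientation, and let $\widehat{dy_i^j}$, $\widehat{d\theta_l^t}$ denote the product $dV$ with the factor $dy_i^j$, resp. $d\theta_l^t$, omitted. On $\Lambda$-valued differential forms, the Cauchy–Riemann operator is $$d''=\sum_{i=1}^n\sum_{j=1}^p dy_i^j\wedge\Big(\frac{\partial}{\partial y_i^j}-e_j\frac{\partial}{\partial y_i^0}\Big)+\sum_{l=1}^m\sum_{k=1}^r\sum_{t=s_k+1}^{s_{k+1}-1}d\theta_l^t\wedge\Big(\frac{\partial}{\partial\theta_l^t}-a_t\frac{\partial}{\partial\theta_l^{s_k}}\Big).$$ Then the $\Lambda$-valued form of degree $N-1$ $$\Omega=\frac{c}{\|x\|^{N}}\Big[\sum_{i=1}^n\sum_{j=1}^p(-1)^{(p+1)(i-1)+j}(y_i^je_0+y_i^0e_j)\,\widehat{dy_i^j}+\sum_{l=1}^m\sum_{k=1}^r\sum_{t=s_k+1}^{s_{k+1}-1}(-1)^{n(p+1)+t-1}(\theta_l^te_0+\theta_l^{s_k}a_t)\,\widehat{d\theta_l^t}\Big],$$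 $$c=-\big(N\,\mathrm{Vol}(B(0,1))\big)^{-1},$$ where $\mathrm{Vol}(B(0,1))$ is the volume of the Euclidean unit ball of dimension $N$, is a fundamental solution of $d''$: its coefficients are locally integrable and $d''\Omega=[0]$ in the sense of currents, where $[0]$ is evaluation at the origin, an $(N-1)$-form acts on test 1-forms by $\langle\Omega,\alpha\rangle=\int\alpha\wedge\Omega$, and $\langle d''\Omega,\varphi\rangle=\langle\Omega,d''\varphi\rangle$. That is, for every smooth compactly supported $\varphi:\Lambda_0^n\times\Lambda_1^m\to\Lambda$, $$\int_{\Lambda_0^n\times\Lambda_1^m}d''\varphi\wedge\Omega=\varphi(0).$$ For $n=1$, $m=0$ this is the fundamental solution of $d''$ on $\Lambda_0$, under $(A_0)$ alone. -/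

import Mathlib

noncomputable section

namespace Superanalysis

/-- Supercommutativity of a `ZMod 2`-graded algebra: `a b = (-1)^{σ(a)σ(b)} b a` for homogeneous
`a`, `b`. -/
def IsSupercommutative {Λ : Type*} [Ring Λ] [Algebra ℝ Λ] (𝒜 : ZMod 2 → Submodule ℝ Λ) : Prop :=
  ∀ i j : ZMod 2, ∀ a ∈ 𝒜 i, ∀ b ∈ 𝒜 j, a * b = (-1) ^ (i.val * j.val) * (b * a)

/-- A finite sequence `0 = s₀ < s₁ < ⋯ < s_r = q`. It cuts `Fin q` into the `r` consecutive blocks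
`{t | s_k ≤ t < s_{k+1}}` (all indices start at `0`). -/
structure Blocks (q r : ℕ) where
  s : Fin (r + 1) → ℕ
  strictMono : StrictMono s
  first : s 0 = 0
  last : s (Fin.last r) = q

/-- The first index `s_k` of the `k`-th block. -/
def Blocks.head {q r : ℕ} (S : Blocks q r) (k : Fin r) : Fin q :=
  ⟨S.s k.castSucc, by
    have h1 : S.s k.castSucc < S.s k.succ := S.strictMono Fin.castSucc_lt_succ
    have h2 : S.s k.succ ≤ S.s (Fin.last r) := S.strictMono.monotone (Fin.le_last _)
    have h3 := S.last
    omega⟩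

/-- The `k`-th block `{t | s_k ≤ t < s_{k+1}}`. -/
def Blocks.block {q r : ℕ} (S : Blocks q r) (k : Fin r) : Finset (Fin q) :=
  Finset.univ.filter fun t => S.s k.castSucc ≤ (t : ℕ) ∧ (t : ℕ) < S.s k.succ

/-- The `k`-th block without its first index, `{t | s_k < t < s_{k+1}}`. -/
def Blocks.tail {q r : ℕ} (S : Blocks q r) (k : Fin r) : Finset (Fin q) :=
  Finset.univ.filter fun t => S.s k.castSucc < (t : ℕ) ∧ (t : ℕ) < S.s k.succ

section

variable {Λ : Type*} [NormedRing Λ] [NormedAlgebra ℝ Λ] [FiniteDimensional ℝ Λ]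
variable {𝒜 : ZMod 2 → Submodule ℝ Λ}

/-- Condition `(A₀)` for a basis `(e₀, …, e_p)` of `Λ₀`: `e₀ = 1` and `∑ e_k² = 0`. -/
def ConditionA0 {p : ℕ} (e : Module.Basis (Fin (p + 1)) ℝ (𝒜 0)) : Prop :=
  (e 0 : Λ) = 1 ∧ ∑ k, (e k : Λ) ^ 2 = 0

/-- Condition `(A₁)` for a basis `(ε_t)` of `Λ₁`, a cutting of its index set into blocks and
elements `a_t` of `Λ₀`: `ε_t = a_t ε_{s_k}` on the `k`-th block, `a_{s_k} = 1`, and the squares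
`a_t²` sum to zero over each block. -/
structure ConditionA1 {q r : ℕ} (ε : Module.Basis (Fin q) ℝ (𝒜 1)) (S : Blocks q r)
    (a : Fin q → 𝒜 0) : Prop where
  generate : ∀ k, ∀ t ∈ S.block k, (ε t : Λ) = (a t : Λ) * (ε (S.head k) : Λ)
  head_eq_one : ∀ k, (a (S.head k) : Λ) = 1
  sum_sq : ∀ k, ∑ t ∈ S.block k, (a t : Λ) ^ 2 = 0

/-- The superspace `Λ₀ⁿ × Λ₁ᵐ`. -/
abbrev Superspace (𝒜 : ZMod 2 → Submodule ℝ Λ) (n m : ℕ) : Type _ :=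
  (Fin n → 𝒜 0) × (Fin m → 𝒜 1)

/-- `Λ`-valued constant-coefficient exterior forms of degree `k` on `Λ₀ⁿ × Λ₁ᵐ`. -/
abbrev ExtForm (𝒜 : ZMod 2 → Submodule ℝ Λ) (n m k : ℕ) : Type _ :=
  Superspace 𝒜 n m [⋀^Fin k]→L[ℝ] Λ

/-- Labels of the real coordinates: `inl (i, j)` for `y_i^j`, `inr (l, t)` for `θ_l^t`. -/
abbrev Label (n m p q : ℕ) : Type := (Fin n × Fin (p + 1)) ⊕ (Fin m × Fin q)

/-- The enumeration `y_1^0, …, y_1^p, …, y_n^0, …, y_n^p, θ_1^1, …, θ_1^q, …, θ_m^1, …, θ_m^q` of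
the real coordinates, where `d + 1` is the real dimension of the superspace. -/
def position {n m p q d : ℕ} (hd : n * (p + 1) + m * q = d + 1) :
    Label n m p q ≃ Fin (d + 1) :=
  ((Equiv.sumCongr finProdFinEquiv finProdFinEquiv).trans finSumFinEquiv).trans (finCongr hd)

variable {n m p q r d : ℕ}

/-- The real coordinate functions `y_i^j` and `θ_l^t`; being linear, they are also the constant
1-forms `dy_i^j` and `dθ_l^t`. -/
def coord (e : Module.Basis (Fin (p + 1)) ℝ (𝒜 0)) (ε : Module.Basis (Fin q) ℝ (𝒜 1)) :
    Label n m p q → (Superspace 𝒜 n m →L[ℝ] ℝ)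
  | .inl (i, j) => LinearMap.toContinuousLinearMap
      (e.coord j ∘ₗ LinearMap.proj i ∘ₗ LinearMap.fst ℝ (Fin n → 𝒜 0) (Fin m → 𝒜 1))
  | .inr (l, t) => LinearMap.toContinuousLinearMap
      (ε.coord t ∘ₗ LinearMap.proj l ∘ₗ LinearMap.snd ℝ (Fin n → 𝒜 0) (Fin m → 𝒜 1))

/-- The vectors of the superspace dual to the coordinates. -/
def coordVec (e : Module.Basis (Fin (p + 1)) ℝ (𝒜 0)) (ε : Module.Basis (Fin q) ℝ (𝒜 1)) :
    Label n m p q → Superspace 𝒜 n m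
  | .inl (i, j) => (Pi.single i (e j), 0)
  | .inr (l, t) => (0, Pi.single l (ε t))

/-- The Euclidean norm on the superspace for which the bases `e` and `ε` are orthonormal. -/
def euclNorm (e : Module.Basis (Fin (p + 1)) ℝ (𝒜 0)) (ε : Module.Basis (Fin q) ℝ (𝒜 1))
    (x : Superspace 𝒜 n m) : ℝ :=
  √(∑ c : Label n m p q, coord e ε c x ^ 2)

/-- The point with given coordinates. -/
def point (e : Module.Basis (Fin (p + 1)) ℝ (𝒜 0)) (ε : Module.Basis (Fin q) ℝ (𝒜 1))
    (hd : n * (p + 1) + m * q = d + 1) (u : EuclideanSpace ℝ (Fin (d + 1))) : Superspace 𝒜 n m :=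
  ∑ b, u b • coordVec e ε ((position hd).symm b)

/-- The determinant as a continuous alternating map of the rows. -/
def detForm (k : ℕ) : (Fin k → ℝ) [⋀^Fin k]→L[ℝ] ℝ where
  toMultilinearMap := (Matrix.detRowAlternating (n := Fin k) (R := ℝ)).toMultilinearMap
  cont := Continuous.matrix_det (A := fun v : Fin k → Fin k → ℝ => Matrix.of v) continuous_id
  map_eq_zero_of_eq' := (Matrix.detRowAlternating (n := Fin k) (R := ℝ)).map_eq_zero_of_eq'

/-- The exterior product `f₀ ∧ ⋯ ∧ f_{k-1}` of real linear forms, `v ↦ det (f_b (v_c))`, as a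
`Λ`-valued form. -/
def wedgeList {k : ℕ} (f : Fin k → (Superspace 𝒜 n m →L[ℝ] ℝ)) : ExtForm 𝒜 n m k :=
  (algebraMapCLM ℝ Λ).compContinuousAlternatingMap
    ((detForm k).compContinuousLinearMap (ContinuousLinearMap.pi f))

/-- The form `dx̂_c`: the exterior product, in the order of `position`, of the differentials of all
real coordinates except the one labelled `c`. -/
def hatForm (e : Module.Basis (Fin (p + 1)) ℝ (𝒜 0)) (ε : Module.Basis (Fin q) ℝ (𝒜 1))
    (hd : n * (p + 1) + m * q = d + 1) (c : Label n m p q) : ExtForm 𝒜 n m d :=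
  wedgeList fun b => coord e ε ((position hd).symm ((position hd c).succAbove b))

/-- The exterior product `ℓ ∧ ω` of a 1-form `ℓ` with a form `ω`:
`(v₀, …, v_k) ↦ ∑ (-1)^i ℓ(v_i) ω(v₀, …, v̂_i, …, v_k)`, the product being that of `Λ`. -/
def wedgeOne {k : ℕ} (l : Superspace 𝒜 n m →L[ℝ] Λ) (ω : ExtForm 𝒜 n m k) :
    ExtForm 𝒜 n m (k + 1) :=
  ContinuousAlternatingMap.alternatizeUncurryFin (𝕜 := ℝ) (E := Superspace 𝒜 n m) (F := Λ)
    (LinearMap.toContinuousLinearMap (l.toLinearMap.smulRight ω))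

/-- The constant 1-form `dx_c`, with values in `Λ`. -/
def dcoord (e : Module.Basis (Fin (p + 1)) ℝ (𝒜 0)) (ε : Module.Basis (Fin q) ℝ (𝒜 1))
    (c : Label n m p q) : Superspace 𝒜 n m →L[ℝ] Λ :=
  (algebraMapCLM ℝ Λ).comp (coord e ε c)

/-- The partial derivative `∂ω/∂x_c` of a differential form, coefficient by coefficient. -/
def partialForm {k : ℕ} (e : Module.Basis (Fin (p + 1)) ℝ (𝒜 0))
    (ε : Module.Basis (Fin q) ℝ (𝒜 1)) (c : Label n m p q)
    (ω : Superspace 𝒜 n m → ExtForm 𝒜 n m k) (x : Superspace 𝒜 n m) : ExtForm 𝒜 n m k :=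
  fderiv ℝ ω x (coordVec e ε c)

/-- The Cauchy–Riemann operator
`d'' ω = ∑_{i, j ≥ 1} dy_i^j ∧ (∂ω/∂y_i^j - e_j ∂ω/∂y_i^0)
  + ∑_{l, k} ∑_{s_k < t < s_{k+1}} dθ_l^t ∧ (∂ω/∂θ_l^t - a_t ∂ω/∂θ_l^{s_k})`
on `Λ`-valued differential forms. -/
def dbar {k : ℕ} (e : Module.Basis (Fin (p + 1)) ℝ (𝒜 0)) (ε : Module.Basis (Fin q) ℝ (𝒜 1))
    (S : Blocks q r) (a : Fin q → 𝒜 0)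
    (ω : Superspace 𝒜 n m → ExtForm 𝒜 n m k) (x : Superspace 𝒜 n m) :
    ExtForm 𝒜 n m (k + 1) :=
  (∑ i : Fin n, ∑ j : Fin p,
      wedgeOne (dcoord e ε (.inl (i, j.succ)))
        (partialForm e ε (.inl (i, j.succ)) ω x
          - (e j.succ : Λ) • partialForm e ε (.inl (i, 0)) ω x))
    + ∑ l : Fin m, ∑ k' : Fin r, ∑ t ∈ S.tail k',
      wedgeOne (dcoord e ε (.inr (l, t)))
        (partialForm e ε (.inr (l, t)) ω x
          - (a t : Λ) • partialForm e ε (.inr (l, S.head k')) ω x)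

/-- A `Λ`-valued function as a differential form of degree `0`. -/
def zeroForm (φ : Superspace 𝒜 n m → Λ) (x : Superspace 𝒜 n m) : ExtForm 𝒜 n m 0 :=
  ContinuousAlternatingMap.constOfIsEmpty ℝ (Superspace 𝒜 n m) (Fin 0) (φ x)

/-- The integral `∫ η` of a form of top degree, for the orientation
`dV = dy_1^0 ∧ ⋯ ∧ dy_n^p ∧ dθ_1^1 ∧ ⋯ ∧ dθ_m^q`: the Lebesgue integral, in the coordinates, of the
coefficient of `η` in front of `dV`. -/
def integralForm (e : Module.Basis (Fin (p + 1)) ℝ (𝒜 0)) (ε : Module.Basis (Fin q) ℝ (𝒜 1))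
    (hd : n * (p + 1) + m * q = d + 1) (η : Superspace 𝒜 n m → ExtForm 𝒜 n m (d + 1)) : Λ :=
  ∫ u : EuclideanSpace ℝ (Fin (d + 1)),
    η (point e ε hd u) fun b => coordVec e ε ((position hd).symm b)

/-- The current defined by a form `ω` of degree `d = dim - 1`, acting on test 1-forms by
`⟨ω, α⟩ = ∫ α ∧ ω`. -/
def currentOf (e : Module.Basis (Fin (p + 1)) ℝ (𝒜 0)) (ε : Module.Basis (Fin q) ℝ (𝒜 1))
    (hd : n * (p + 1) + m * q = d + 1) (ω : Superspace 𝒜 n m → ExtForm 𝒜 n m d)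
    (α : Superspace 𝒜 n m → ExtForm 𝒜 n m 1) : Λ :=
  integralForm e ε hd fun x =>
    wedgeOne ((ContinuousAlternatingMap.ofSubsingleton ℝ (Superspace 𝒜 n m) Λ 0).symm (α x)) (ω x)

/-- The operator `d''` on currents of dimension 1, `⟨d''T, φ⟩ = ⟨T, d''φ⟩`. -/
def dbarCurrent (e : Module.Basis (Fin (p + 1)) ℝ (𝒜 0)) (ε : Module.Basis (Fin q) ℝ (𝒜 1))
    (S : Blocks q r) (a : Fin q → 𝒜 0)
    (T : (Superspace 𝒜 n m → ExtForm 𝒜 n m 1) → Λ) (φ : Superspace 𝒜 n m → Λ) : Λ :=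
  T (dbar e ε S a (zeroForm φ))

/-- The current `[0]` of evaluation at the origin. -/
def evalCurrent (φ : Superspace 𝒜 n m → Λ) : Λ := φ 0

/-- `ω` is a fundamental solution of `d''`: its coefficients are locally integrable, so that it
defines a current, and `d''ω = [0]` as currents, tested against all smooth compactly supported
`Λ`-valued functions. -/
structure IsFundamentalSolution (e : Module.Basis (Fin (p + 1)) ℝ (𝒜 0))
    (ε : Module.Basis (Fin q) ℝ (𝒜 1)) (S : Blocks q r) (a : Fin q → 𝒜 0)
    (hd : n * (p + 1) + m * q = d + 1) (ω : Superspace 𝒜 n m → ExtForm 𝒜 n m d) : Prop where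
  locallyIntegrable : ∀ v : Fin d → Superspace 𝒜 n m, MeasureTheory.LocallyIntegrable
    fun u : EuclideanSpace ℝ (Fin (d + 1)) => ω (point e ε hd u) v
  dbar_eq : ∀ φ : Superspace 𝒜 n m → Λ, ContDiff ℝ (⊤ : ℕ∞) φ → HasCompactSupport φ →
    dbarCurrent e ε S a (currentOf e ε hd ω) φ = evalCurrent φ

/-- The constant `c = -((n(p+1) + qm) Vol(B(0,1)))⁻¹`, the unit ball being that of the Euclidean
space of dimension `d + 1 = n(p+1) + qm`. -/
def fundConst (n m p q d : ℕ) : ℝ :=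
  -(((n * (p + 1) + q * m : ℕ) : ℝ) *
    MeasureTheory.volume.real (Metric.ball (0 : EuclideanSpace ℝ (Fin (d + 1))) 1))⁻¹

/-- The form `Ω = c ‖x‖^{-(n(p+1)+qm)} [ ∑_{i, j ≥ 1} (-1)^{(p+1)(i-1)+j} (y_i^j + y_i^0 e_j) dŷ_i^j
  + ∑_{l, k} ∑_{s_k < t < s_{k+1}} (-1)^{n(p+1)+t-1} (θ_l^t + θ_l^{s_k} a_t) dθ̂_l^t ]`.
In the code the indices `i`, `l`, `t` start at `0`. -/
def fundForm (e : Module.Basis (Fin (p + 1)) ℝ (𝒜 0)) (ε : Module.Basis (Fin q) ℝ (𝒜 1))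
    (S : Blocks q r) (a : Fin q → 𝒜 0) (hd : n * (p + 1) + m * q = d + 1)
    (x : Superspace 𝒜 n m) : ExtForm 𝒜 n m d :=
  (fundConst n m p q d / euclNorm e ε x ^ (n * (p + 1) + q * m)) •
    ((∑ i : Fin n, ∑ j : Fin p,
        (-1 : ℝ) ^ ((p + 1) * (i : ℕ) + (j.succ : ℕ)) •
          ((coord e ε (.inl (i, j.succ)) x • (1 : Λ)
              + coord e ε (.inl (i, 0)) x • (e j.succ : Λ)) •
            hatForm e ε hd (.inl (i, j.succ))))
      + ∑ l : Fin m, ∑ k : Fin r, ∑ t ∈ S.tail k,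
        (-1 : ℝ) ^ (n * (p + 1) + (t : ℕ)) •
          ((coord e ε (.inr (l, t)) x • (1 : Λ)
              + coord e ε (.inr (l, S.head k)) x • (a t : Λ)) •
            hatForm e ε hd (.inr (l, t))))

end

end Superanalysis

end

/-!
In the real coordinates the density of `d''φ ∧ Ω` is `c ‖x‖⁻ᴺ` times a sum, over the coordinates
`x_c` with partner `x_h` and coefficient `b_c`, of `(D_c - b_c D_h) φ · (x_c + x_h b_c)`. Expanding,
the diagonal terms give the derivative of `φ` along the Euler field, the terms linear in `b_c` give
infinitesimal rotations of `φ` with coefficients in `Λ₀`, and the terms in `b_c²` cancel since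
these squares are central and sum to zero. The rotations integrate to zero against a radial weight,
and in polar coordinates the radial derivative divided by `‖x‖ᴺ⁻¹` integrates to
`-N Vol(B(0,1)) φ(0) = c⁻¹ φ(0)`.

The signs in `Ω` are those of `dx_c ∧ dx̂_c` only up to `(-1)^{q l}`. But `(A₁)` forces `q` to be
even: multiplication by the `a_t` of a block makes `Λ₁` a module over a commutative real algebra in
which `-1` is a sum of squares, and the simple modules of such an algebra are complex lines.
-/

noncomputable section

namespace Superanalysis

open MeasureTheory Set Metric Filter Topology

section Parity

theorem isSumSq_map {R A : Type*} [NonAssocSemiring R] [NonAssocSemiring A] (f : R →+* A) {x : R}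
    (hx : IsSumSq x) : IsSumSq (f x) := by
  induction hx with
  | zero => exact map_zero f ▸ IsSumSq.zero
  | sq_add y _ ih =>
    rw [map_add, map_mul]
    exact ih.sq_add (f y)

theorem even_finrank_of_isSimpleModule {R : Type*} [CommRing R] [Algebra ℝ R]
    (hR : IsSumSq (-1 : R)) (M : Type*) [AddCommGroup M] [Module ℝ M] [Module R M]
    [IsScalarTower ℝ R M] [FiniteDimensional ℝ M] [IsSimpleModule R M] :
    Even (Module.finrank ℝ M) := by
  obtain ⟨I, hI, ⟨f⟩⟩ := isSimpleModule_iff_quot_maximal.mp (inferInstance : IsSimpleModule R M)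
  let _ := Ideal.Quotient.field I
  let g : M ≃ₗ[ℝ] (R ⧸ I) := f.restrictScalars ℝ
  have : FiniteDimensional ℝ (R ⧸ I) := Module.Finite.equiv g
  rw [g.finrank_eq]
  rcases Real.nonempty_algEquiv_or (R ⧸ I) with ⟨⟨toReal⟩⟩ | ⟨⟨toComplex⟩⟩
  · have hneg : IsSumSq (-1 : ℝ) := by
      simpa using isSumSq_map (toReal.toRingHom.comp (Ideal.Quotient.mk I)) hR
    linarith [hneg.nonneg]
  · rw [toComplex.toLinearEquiv.finrank_eq, Complex.finrank_real_complex]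
    exact even_two

theorem even_finrank_of_isSumSq_neg_one {R : Type*} [CommRing R] [Algebra ℝ R]
    (hR : IsSumSq (-1 : R)) (M : Type*) [AddCommGroup M] [Module ℝ M] [Module R M]
    [IsScalarTower ℝ R M] [FiniteDimensional ℝ M] : Even (Module.finrank ℝ M) := by
  induction h : Module.finrank ℝ M using Nat.strong_induction_on generalizing M with
  | _ k ih =>
    subst h
    have : Module.Finite R M := Module.Finite.of_restrictScalars_finite ℝ R M
    rcases subsingleton_or_nontrivial M with hM | hM
    · rw [Module.finrank_zero_of_subsingleton]
      exact Even.zero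
    · obtain ⟨N, hN⟩ := IsCoatomic.exists_coatom (Submodule R M)
      have : IsSimpleModule R (M ⧸ N) := isSimpleModule_iff_isCoatom.mpr hN
      have : FiniteDimensional ℝ (M ⧸ N) :=
        inferInstanceAs (FiniteDimensional ℝ (M ⧸ N.restrictScalars ℝ))
      have : FiniteDimensional ℝ N :=
        inferInstanceAs (FiniteDimensional ℝ (N.restrictScalars ℝ))
      have hsum : Module.finrank ℝ (M ⧸ N) + Module.finrank ℝ N = Module.finrank ℝ M :=
        Submodule.finrank_quotient_add_finrank (N.restrictScalars ℝ)
      have : Nontrivial (M ⧸ N) := IsSimpleModule.nontrivial R (M ⧸ N)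
      have hpos : 0 < Module.finrank ℝ (M ⧸ N) := Module.finrank_pos
      rw [← hsum]
      exact (even_finrank_of_isSimpleModule hR (M ⧸ N)).add (ih _ (by lia) N rfl)

open scoped IsMulCommutative in
theorem even_finrank_of_sum_sq_eq_zero {V : Type*} [AddCommGroup V] [Module ℝ V]
    [FiniteDimensional ℝ V] {ι : Type*} {T : ι → Module.End ℝ V}
    (hT : ∀ i j, Commute (T i) (T j)) {s : Finset ι} {i₀ : ι} (hi₀ : i₀ ∈ s) (hone : T i₀ = 1)
    (hsq : ∑ i ∈ s, T i ^ 2 = 0) : Even (Module.finrank ℝ V) := by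
  classical
  let R := Algebra.adjoin ℝ (Set.range T)
  have : IsMulCommutative R :=
    Algebra.isMulCommutative_adjoin ℝ (by rintro _ ⟨i, rfl⟩ _ ⟨j, rfl⟩; exact hT i j)
  let T' : ι → R := fun i => ⟨T i, Algebra.subset_adjoin ⟨i, rfl⟩⟩
  have hneg : (-1 : R) = ∑ i ∈ s.erase i₀, T' i ^ 2 := by
    refine neg_eq_of_add_eq_zero_right (Subtype.ext ?_)
    rw [← Finset.add_sum_erase s _ hi₀, hone, one_pow] at hsq
    simpa [T'] using hsq
  exact even_finrank_of_isSumSq_neg_one (R := R) (hneg ▸ IsSumSq.sum_sq _ _) V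

end Parity

section PolarCoordinates

variable {E F : Type*} [NormedAddCommGroup E] [NormedSpace ℝ E] [MeasurableSpace E]
  [BorelSpace E] [FiniteDimensional ℝ E] [Nontrivial E] [NormedAddCommGroup F] [NormedSpace ℝ F]

theorem integral_volumeIoiPow (k : ℕ) (f : ℝ → F) :
    ∫ r : Ioi (0 : ℝ), f r ∂.volumeIoiPow k = ∫ r in Ioi (0 : ℝ), r ^ k • f r := by
  simp only [Measure.volumeIoiPow, ENNReal.ofReal]
  rw [integral_withDensity_eq_integral_smul,
    integral_subtype_comap measurableSet_Ioi fun r => Real.toNNReal (r ^ k) • f r,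
    setIntegral_congr_fun measurableSet_Ioi fun r hr => ?_]
  · rw [NNReal.smul_def, Real.coe_toNNReal _ (pow_nonneg hr.out.le _)]
  · exact (measurable_subtype_coe.pow_const _).real_toNNReal

theorem integral_eq_integral_toSphere_integral_Ioi (μ : Measure E) [μ.IsAddHaarMeasure]
    {f : E → F} (hf : Integrable f μ) :
    ∫ x, f x ∂μ = ∫ σ : sphere (0 : E) 1, (∫ r in Ioi (0 : ℝ),
      r ^ (Module.finrank ℝ E - 1) • f (r • (σ : E))) ∂μ.toSphere := by
  have hpres := μ.measurePreserving_homeomorphUnitSphereProd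
  have hemb := (homeomorphUnitSphereProd E).measurableEmbedding
  let g : sphere (0 : E) 1 × Ioi (0 : ℝ) → F := fun z => f ((z.2 : ℝ) • (z.1 : E))
  have hg (x : ({0}ᶜ : Set E)) : g (homeomorphUnitSphereProd E x) = f x := by
    have hx : ‖(x : E)‖ ≠ 0 := norm_ne_zero_iff.2 x.2
    simp [g, smul_smul, hx]
  have hgint : Integrable g (μ.toSphere.prod (.volumeIoiPow (Module.finrank ℝ E - 1))) := by
    rw [← hpres.integrable_comp_emb hemb, show g ∘ homeomorphUnitSphereProd E = f ∘ (↑) from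
      funext hg, ← integrableOn_iff_comap_subtypeVal (measurableSet_singleton _).compl]
    exact hf.integrableOn
  calc
    ∫ x, f x ∂μ = ∫ x : ({0}ᶜ : Set E), f x ∂(μ.comap (↑)) := by
      rw [integral_subtype_comap (measurableSet_singleton _).compl f, restrict_compl_singleton]
    _ = ∫ z, g z ∂μ.toSphere.prod (.volumeIoiPow (Module.finrank ℝ E - 1)) := by
      rw [← hpres.integral_comp hemb]
      exact integral_congr_ae (.of_forall fun x => (hg x).symm)
    _ = ∫ σ : sphere (0 : E) 1, ∫ r : Ioi (0 : ℝ), f ((r : ℝ) • (σ : E))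
          ∂.volumeIoiPow (Module.finrank ℝ E - 1) ∂μ.toSphere := integral_prod _ hgint
    _ = _ := by
      exact integral_congr_ae (.of_forall fun σ =>
        integral_volumeIoiPow _ fun r => f (r • (σ : E)))

end PolarCoordinates

section NormPower

variable {E F : Type*} [NormedAddCommGroup E] [NormedSpace ℝ E] [FiniteDimensional ℝ E]
  [Nontrivial E] [NormedAddCommGroup F] [NormedSpace ℝ F]

theorem integral_Ioi_inv_pow_smul_fderiv_smul [CompleteSpace F] {ψ : E → F}
    (hψ : ContDiff ℝ 1 ψ) (hc : HasCompactSupport ψ) {σ : E} (hσ : ‖σ‖ = 1) :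
    ∫ r in Ioi (0 : ℝ), r ^ (Module.finrank ℝ E - 1) •
      ((‖r • σ‖ ^ Module.finrank ℝ E)⁻¹ • fderiv ℝ ψ (r • σ) (r • σ)) = -ψ 0 := by
  have hray : ContDiff ℝ 1 fun r : ℝ => ψ (r • σ) := hψ.comp (contDiff_id.smul contDiff_const)
  have hray_supp : HasCompactSupport fun r : ℝ => ψ (r • σ) :=
    hc.comp_isClosedEmbedding (isClosedEmbedding_smul_left (norm_ne_zero_iff.1 (by simp [hσ])))
  have hderiv (r : ℝ) : deriv (fun r : ℝ => ψ (r • σ)) r = fderiv ℝ ψ (r • σ) σ := by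
    have hline : HasDerivAt (fun r : ℝ => r • σ) σ r := by
      simpa using (hasDerivAt_id r).smul_const σ
    exact ((hψ.differentiable one_ne_zero _).hasFDerivAt.comp_hasDerivAt r hline).deriv
  have hftc := hray_supp.integral_Ioi_deriv_eq hray 0
  rw [zero_smul] at hftc
  rw [← hftc]
  refine setIntegral_congr_fun measurableSet_Ioi fun r (hr : 0 < r) => ?_
  have hweight : r ^ (Module.finrank ℝ E - 1) * ((r ^ Module.finrank ℝ E)⁻¹ * r) = 1 := by
    rw [← pow_sub_one_mul (Module.finrank_pos (R := ℝ) (M := E)).ne' r]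
    field_simp
  simp only [hderiv, norm_smul, hσ, mul_one, Real.norm_of_nonneg hr.le, map_smul, smul_smul]
  rw [hweight, one_smul]

variable [MeasurableSpace E] [BorelSpace E]

theorem locallyIntegrable_inv_norm_pow (μ : Measure E) [μ.IsAddHaarMeasure] :
    LocallyIntegrable (fun u : E => (‖u‖ ^ (Module.finrank ℝ E - 1))⁻¹) μ := by
  intro x
  refine ⟨ball 0 (‖x‖ + 1), isOpen_ball.mem_nhds (by simp), ?_⟩
  rw [integrableOn_fun_norm_addHaar (E := E) μ
    (f := fun y : ℝ => (y ^ (Module.finrank ℝ E - 1))⁻¹)]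
  refine (integrableOn_congr_fun (fun y hy => ?_) measurableSet_Ioo).mpr
    (integrableOn_const (C := (1 : ℝ)) (by simp))
  have : y ≠ 0 := hy.1.ne'
  simp [this]

theorem locallyIntegrable_inv_norm_pow_smul {μ : Measure E} [μ.IsAddHaarMeasure] {g : E → F}
    (hg : AEStronglyMeasurable g μ) {C : ℝ} (hC : ∀ u, ‖g u‖ ≤ C * ‖u‖) :
    LocallyIntegrable (fun u => (‖u‖ ^ Module.finrank ℝ E)⁻¹ • g u) μ := by
  have hweight : Measurable fun u : E => (‖u‖ ^ Module.finrank ℝ E)⁻¹ := by fun_prop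
  refine ((locallyIntegrable_inv_norm_pow μ).smul C).mono
    (hweight.aestronglyMeasurable.smul hg) (.of_forall fun u => ?_)
  calc ‖(‖u‖ ^ Module.finrank ℝ E)⁻¹ • g u‖
      = (‖u‖ ^ Module.finrank ℝ E)⁻¹ * ‖g u‖ := by simp [norm_smul]
    _ ≤ (‖u‖ ^ Module.finrank ℝ E)⁻¹ * (C * ‖u‖) := by gcongr; exact hC u
    _ = (‖u‖ ^ (Module.finrank ℝ E - 1))⁻¹ * (C * (‖u‖⁻¹ * ‖u‖)) := by
      rw [← pow_sub_one_mul (Module.finrank_pos (R := ℝ) (M := E)).ne' ‖u‖, mul_inv]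
      ring
    _ ≤ ‖C • (‖u‖ ^ (Module.finrank ℝ E - 1))⁻¹‖ := by
      rw [norm_smul, norm_inv, norm_pow, norm_norm, mul_comm ‖C‖]
      have : C * (‖u‖⁻¹ * ‖u‖) ≤ ‖C‖ := by
        rcases eq_or_ne ‖u‖ 0 with hu | hu
        · simp [hu]
        · simpa [hu] using le_abs_self C
      gcongr

theorem locallyIntegrable_inv_norm_pow_smul_clm (μ : Measure E) [μ.IsAddHaarMeasure]
    (A : E →L[ℝ] F) : LocallyIntegrable (fun u => (‖u‖ ^ Module.finrank ℝ E)⁻¹ • A u) μ :=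
  locallyIntegrable_inv_norm_pow_smul A.continuous.aestronglyMeasurable A.le_opNorm

theorem integrable_inv_norm_pow_smul_fderiv (μ : Measure E) [μ.IsAddHaarMeasure] {ψ : E → F}
    (hψ : ContDiff ℝ 1 ψ) (hc : HasCompactSupport ψ) (A : E →L[ℝ] E) :
    Integrable (fun u => (‖u‖ ^ Module.finrank ℝ E)⁻¹ • fderiv ℝ ψ u (A u)) μ := by
  have hfderiv := hψ.continuous_fderiv one_ne_zero
  obtain ⟨C, hC⟩ := hfderiv.bounded_above_of_compact_support (hc.fderiv ℝ)
  have hloc : LocallyIntegrable (fun u => (‖u‖ ^ Module.finrank ℝ E)⁻¹ • fderiv ℝ ψ u (A u)) μ := by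
    refine locallyIntegrable_inv_norm_pow_smul (C := C * ‖A‖)
      (hfderiv.clm_apply A.continuous).aestronglyMeasurable fun u => ?_
    rw [mul_assoc]
    exact (fderiv ℝ ψ u).le_of_opNorm_le_of_le (hC u) (A.le_opNorm u)
  rw [← integrableOn_iff_integrable_of_support_subset]
  · exact hloc.integrableOn_isCompact hc
  · refine fun u hu => support_fderiv_subset ℝ fun h => hu ?_
    simp only [h, zero_apply, smul_zero]

theorem integral_inv_norm_pow_smul_fderiv_self (μ : Measure E) [μ.IsAddHaarMeasure]
    [CompleteSpace F] {ψ : E → F} (hψ : ContDiff ℝ 1 ψ) (hc : HasCompactSupport ψ) :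
    ∫ u, (‖u‖ ^ Module.finrank ℝ E)⁻¹ • fderiv ℝ ψ u u ∂μ
      = -((Module.finrank ℝ E * μ.real (ball 0 1)) • ψ 0) := by
  have hint : Integrable (fun u => (‖u‖ ^ Module.finrank ℝ E)⁻¹ • fderiv ℝ ψ u u) μ :=
    integrable_inv_norm_pow_smul_fderiv μ hψ hc (.id ℝ E)
  rw [integral_eq_integral_toSphere_integral_Ioi μ hint]
  simp only [integral_Ioi_inv_pow_smul_fderiv_smul hψ hc (norm_eq_of_mem_sphere _),
    integral_const, Measure.toSphere_real_apply_univ, smul_neg]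

end NormPower

section VectorFields

variable {E F : Type*} [NormedAddCommGroup E] [NormedSpace ℝ E] [MeasurableSpace E]
  [BorelSpace E] [FiniteDimensional ℝ E] [NormedAddCommGroup F] [NormedSpace ℝ F]

theorem integral_fderiv_apply_eq_neg_integral_trace_smul (μ : Measure E) [μ.IsAddHaarMeasure]
    {ψ : E → F} (hψ : ContDiff ℝ 1 ψ) (hc : HasCompactSupport ψ) {V : E → E}
    (hV : ContDiff ℝ 1 V) :
    ∫ u, fderiv ℝ ψ u (V u) ∂μ
      = -∫ u, LinearMap.trace ℝ E (fderiv ℝ V u : E →ₗ[ℝ] E) • ψ u ∂μ := by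
  let b := Module.finBasis ℝ E
  let v (i) (u : E) : ℝ := (b.coord i).toContinuousLinearMap (V u)
  have hv (i) : ContDiff ℝ 1 (v i) := ((b.coord i).toContinuousLinearMap.contDiff).comp hV
  have hfderiv_v (i u) : fderiv ℝ (v i) u (b i) = b.coord i (fderiv ℝ V u (b i)) :=
    congrArg (· (b i)) (((b.coord i).toContinuousLinearMap.hasFDerivAt.comp u
      (hV.differentiable one_ne_zero u).hasFDerivAt).fderiv)
  have hint (i) : Integrable (fun u => v i u • fderiv ℝ ψ u (b i)) μ :=
    ((hv i).continuous.smul ((hψ.continuous_fderiv one_ne_zero).clm_apply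
      continuous_const)).integrable_of_hasCompactSupport (hc.fderiv_apply ℝ _).smul_left
  have hint' (i) : Integrable (fun u => fderiv ℝ (v i) u (b i) • ψ u) μ :=
    ((((hv i).continuous_fderiv one_ne_zero).clm_apply continuous_const).smul
      hψ.continuous).integrable_of_hasCompactSupport hc.smul_left
  have hparts (i) : ∫ u, v i u • fderiv ℝ ψ u (b i) ∂μ
      = -∫ u, fderiv ℝ (v i) u (b i) • ψ u ∂μ :=
    integral_smul_fderiv_eq_neg_fderiv_smul_of_integrable (hint' i) (hint i)
      (((hv i).continuous.smul hψ.continuous).integrable_of_hasCompactSupport hc.smul_left)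
      (fun u _ => (hv i).differentiable one_ne_zero u)
      (fun u _ => hψ.differentiable one_ne_zero u)
  have hexpand (u) : fderiv ℝ ψ u (V u) = ∑ i, v i u • fderiv ℝ ψ u (b i) := by
    conv_lhs => rw [← b.sum_repr (V u), map_sum]
    simp only [map_smul]
    rfl
  have htrace (u) : LinearMap.trace ℝ E (fderiv ℝ V u : E →ₗ[ℝ] E)
      = ∑ i, fderiv ℝ (v i) u (b i) := by
    simp [LinearMap.trace_eq_matrix_trace ℝ b, Matrix.trace, LinearMap.toMatrix_apply, hfderiv_v]
  simp only [hexpand, htrace, Finset.sum_smul]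
  rw [integral_finsetSum _ fun i _ => hint i, integral_finsetSum _ fun i _ => hint' i,
    ← Finset.sum_neg_distrib]
  exact Finset.sum_congr rfl fun i _ => hparts i

theorem integral_smul_fderiv_apply_eq_zero (μ : Measure E) [μ.IsAddHaarMeasure]
    {ψ : E → F} (hψ : ContDiff ℝ 1 ψ) (hc : HasCompactSupport ψ) {A : E →L[ℝ] E}
    (hA : LinearMap.trace ℝ E (A : E →ₗ[ℝ] E) = 0) {G : E → ℝ} (hG : ContDiff ℝ 1 G)
    (hGA : ∀ u, fderiv ℝ G u (A u) = 0) : ∫ u, G u • fderiv ℝ ψ u (A u) ∂μ = 0 := by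
  have hV : ContDiff ℝ 1 fun u => G u • A u := hG.smul A.contDiff
  have htrace (u) :
      LinearMap.trace ℝ E (fderiv ℝ (fun u => G u • A u) u : E →ₗ[ℝ] E) = 0 := by
    rw [fderiv_fun_smul (hG.differentiable one_ne_zero u) A.differentiableAt, A.fderiv]
    change LinearMap.trace ℝ E (G u • (A : E →ₗ[ℝ] E)
      + (fderiv ℝ G u : E →ₗ[ℝ] ℝ).smulRight (A u)) = 0
    rw [map_add, map_smul, hA, smul_zero, zero_add, LinearMap.trace_smulRight]
    exact hGA u
  simpa [htrace] using integral_fderiv_apply_eq_neg_integral_trace_smul μ hψ hc hV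

end VectorFields

section RegularizedKernel

variable {E : Type*} [NormedAddCommGroup E]

/-- The kernel `u ↦ ‖u‖⁻ᴺ` with its singularity removed by replacing `‖u‖²` with `‖u‖² + δ`. -/
def regularizedKernel (N : ℕ) (δ : ℝ) (u : E) : ℝ := (√(‖u‖ ^ 2 + δ) ^ N)⁻¹

theorem regularizedKernel_nonneg (N : ℕ) (δ : ℝ) (u : E) : 0 ≤ regularizedKernel N δ u := by
  unfold regularizedKernel
  positivity

theorem regularizedKernel_le (N : ℕ) {δ : ℝ} (hδ : 0 ≤ δ) {u : E} (hu : u ≠ 0) :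
    regularizedKernel N δ u ≤ (‖u‖ ^ N)⁻¹ := by
  have : 0 < ‖u‖ := norm_pos_iff.2 hu
  have : ‖u‖ ≤ √(‖u‖ ^ 2 + δ) := Real.le_sqrt_of_sq_le (le_add_of_nonneg_right hδ)
  unfold regularizedKernel
  gcongr

theorem tendsto_regularizedKernel (N : ℕ) {u : E} (hu : u ≠ 0) :
    Tendsto (fun δ => regularizedKernel N δ u) (𝓝[>] 0) (𝓝 (‖u‖ ^ N)⁻¹) := by
  have hsqrt : Tendsto (fun δ => √(‖u‖ ^ 2 + δ)) (𝓝[>] 0) (𝓝 ‖u‖) := by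
    have hcont : Continuous fun δ => √(‖u‖ ^ 2 + δ) := by fun_prop
    simpa using (hcont.tendsto 0).mono_left nhdsWithin_le_nhds
  exact (hsqrt.pow N).inv₀ (pow_ne_zero N (norm_ne_zero_iff.2 hu))

variable [InnerProductSpace ℝ E]

theorem contDiff_regularizedKernel (N : ℕ) {δ : ℝ} (hδ : 0 < δ) :
    ContDiff ℝ 1 (regularizedKernel N δ : E → ℝ) := by
  have hpos (u : E) : 0 < ‖u‖ ^ 2 + δ := by positivity
  exact ((((contDiff_norm_sq ℝ).add contDiff_const).sqrt fun u => (hpos u).ne').pow N).inv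
    fun u => (pow_pos (Real.sqrt_pos.2 (hpos u)) N).ne'

theorem fderiv_regularizedKernel_apply_eq_zero (N : ℕ) {δ : ℝ} (hδ : 0 < δ) {u v : E}
    (huv : inner ℝ u v = 0) : fderiv ℝ (regularizedKernel N δ) u v = 0 := by
  have hpos : 0 < ‖u‖ ^ 2 + δ := by positivity
  have hradial : DifferentiableAt ℝ (fun s => (√(s + δ) ^ N)⁻¹) (‖u‖ ^ 2) :=
    (((differentiableAt_id.add_const δ).sqrt hpos.ne').pow N).inv
      (pow_pos (Real.sqrt_pos.2 hpos) N).ne'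
  have h := (hradial.hasDerivAt.comp_hasFDerivAt u
    (hasStrictFDerivAt_norm_sq (F := E) u).hasFDerivAt).fderiv
  change fderiv ℝ (regularizedKernel N δ) u = _ at h
  simp [h, huv]

end RegularizedKernel

section Rotations

variable {E F : Type*} [NormedAddCommGroup E] [InnerProductSpace ℝ E]
  [NormedAddCommGroup F] [NormedSpace ℝ F]

/-- The vector field `u ↦ ⟪v, u⟫ w - ⟪w, u⟫ v`, which generates the rotations of the plane spanned
by `v` and `w`. -/
def infinitesimalRotation (v w : E) : E →L[ℝ] E :=
  (innerSL ℝ v).smulRight w - (innerSL ℝ w).smulRight v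

theorem infinitesimalRotation_apply (v w u : E) :
    infinitesimalRotation v w u = inner ℝ v u • w - inner ℝ w u • v := rfl

theorem inner_infinitesimalRotation_self (v w u : E) :
    inner ℝ u (infinitesimalRotation v w u) = 0 := by
  simp only [infinitesimalRotation_apply, inner_sub_right, inner_smul_right, real_inner_comm u]
  ring

variable [FiniteDimensional ℝ E]

theorem trace_eq_zero_of_inner_apply_self_eq_zero {A : E →ₗ[ℝ] E}
    (hA : ∀ u, inner ℝ u (A u) = 0) : LinearMap.trace ℝ E A = 0 := by
  rw [LinearMap.trace_eq_sum_inner A (stdOrthonormalBasis ℝ E)]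
  exact Finset.sum_eq_zero fun i _ => hA _

variable [MeasurableSpace E] [BorelSpace E] [Nontrivial E]

theorem integral_inv_norm_pow_smul_fderiv_eq_zero (μ : Measure E) [μ.IsAddHaarMeasure]
    {ψ : E → F} (hψ : ContDiff ℝ 1 ψ) (hc : HasCompactSupport ψ) {A : E →L[ℝ] E}
    (hA : ∀ u, inner ℝ u (A u) = 0) :
    ∫ u, (‖u‖ ^ Module.finrank ℝ E)⁻¹ • fderiv ℝ ψ u (A u) ∂μ = 0 := by
  set N := Module.finrank ℝ E
  have hsmooth {δ : ℝ} (hδ : 0 < δ) :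
      ∫ u, regularizedKernel N δ u • fderiv ℝ ψ u (A u) ∂μ = 0 :=
    integral_smul_fderiv_apply_eq_zero μ hψ hc (trace_eq_zero_of_inner_apply_self_eq_zero hA)
      (contDiff_regularizedKernel N hδ)
      fun u => fderiv_regularizedKernel_apply_eq_zero N hδ (hA u)
  have hlim : Tendsto (fun δ => ∫ u, regularizedKernel N δ u • fderiv ℝ ψ u (A u) ∂μ) (𝓝[>] 0)
      (𝓝 (∫ u, (‖u‖ ^ N)⁻¹ • fderiv ℝ ψ u (A u) ∂μ)) := by
    refine tendsto_integral_filter_of_dominated_convergence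
      (fun u => ‖(‖u‖ ^ N)⁻¹ • fderiv ℝ ψ u (A u)‖) ?_ ?_
      (integrable_inv_norm_pow_smul_fderiv μ hψ hc A).norm (.of_forall fun u => ?_)
    · filter_upwards [self_mem_nhdsWithin] with δ hδ
      exact ((contDiff_regularizedKernel N hδ).continuous.smul ((hψ.continuous_fderiv
        one_ne_zero).clm_apply A.continuous)).aestronglyMeasurable
    · filter_upwards [self_mem_nhdsWithin] with δ hδ
      refine .of_forall fun u => ?_
      rcases eq_or_ne u 0 with rfl | hu
      · simp
      · rw [norm_smul, norm_smul, Real.norm_of_nonneg (regularizedKernel_nonneg N δ u),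
          Real.norm_of_nonneg (by positivity)]
        gcongr
        exact regularizedKernel_le N (le_of_lt hδ) hu
    · rcases eq_or_ne u 0 with rfl | hu
      · simp
      · exact (tendsto_regularizedKernel N hu).smul_const _
  refine tendsto_nhds_unique hlim (tendsto_const_nhds.congr' ?_)
  filter_upwards [self_mem_nhdsWithin] with δ hδ using (hsmooth hδ).symm

end Rotations

section CauchyRiemann

theorem sum_cauchyRiemann_mul {R Λ ι : Type*} [CommRing R] [Ring Λ] [Algebra R Λ] [Fintype ι]
    [DecidableEq ι] {head : ι → ι} {b : ι → Λ} (hb : ∀ c y, Commute (b c) y)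
    (hsq : ∀ k, ∑ c with head c = k, b c ^ 2 = 0) (D : ι → Λ) (X : ι → R) :
    ∑ c, (D c - b c * D (head c)) * (X c • 1 + X (head c) • b c)
      = ∑ c, X c • D c + ∑ c, b c * (X (head c) • D c - X c • D (head c)) := by
  have hterm (c : ι) : (D c - b c * D (head c)) * (X c • 1 + X (head c) • b c)
      = X c • D c + b c * (X (head c) • D c - X c • D (head c))
        - X (head c) • (b c ^ 2 * D (head c)) := by
    simp only [mul_add, sub_mul, mul_sub, mul_smul_comm, mul_one, pow_two, smul_sub]
    rw [← (hb c (D c)).eq, ← (hb c (b c * D (head c))).eq, mul_assoc]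
    abel
  have hcancel : ∑ c, X (head c) • (b c ^ 2 * D (head c)) = 0 := by
    rw [← Finset.sum_fiberwise Finset.univ head]
    refine Finset.sum_eq_zero fun k _ => ?_
    rw [Finset.sum_congr rfl (g := fun c => X k • (b c ^ 2 * D k)) (by simp +contextual),
      ← Finset.smul_sum, ← Finset.sum_mul, hsq, zero_mul, smul_zero]
  simp only [hterm, Finset.sum_sub_distrib, Finset.sum_add_distrib, hcancel, sub_zero]

variable {Λ ι E : Type*} [NormedRing Λ] [NormedAlgebra ℝ Λ] [Fintype ι]
  [NormedAddCommGroup E] [InnerProductSpace ℝ E]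

theorem sum_cauchyRiemann_mul_eq_euler_add_rotations [DecidableEq ι] (B : OrthonormalBasis ι ℝ E)
    {head : ι → ι} {b : ι → Λ} (hb : ∀ c y, Commute (b c) y)
    (hsq : ∀ k, ∑ c with head c = k, b c ^ 2 = 0) (D : E →L[ℝ] Λ) (u : E) :
    ∑ c, (D (B c) - b c * D (B (head c)))
        * (inner ℝ (B c) u • 1 + inner ℝ (B (head c)) u • b c)
      = D u + ∑ c, b c * D (infinitesimalRotation (B (head c)) (B c) u) := by
  rw [sum_cauchyRiemann_mul hb hsq]
  congr 1
  · conv_rhs => rw [← B.sum_repr' u, map_sum]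
    simp only [map_smul]
  · simp only [infinitesimalRotation_apply, map_sub, map_smul]

variable [FiniteDimensional ℝ E] [MeasurableSpace E] [BorelSpace E] [Nontrivial E]

theorem integral_inv_norm_pow_smul_sum_cauchyRiemann [CompleteSpace Λ] [DecidableEq ι]
    (μ : Measure E) [μ.IsAddHaarMeasure] (B : OrthonormalBasis ι ℝ E) {head : ι → ι}
    {b : ι → Λ} (hb : ∀ c y, Commute (b c) y) (hsq : ∀ k, ∑ c with head c = k, b c ^ 2 = 0)
    {ψ : E → Λ} (hψ : ContDiff ℝ 1 ψ) (hc : HasCompactSupport ψ) :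
    ∫ u, (‖u‖ ^ Module.finrank ℝ E)⁻¹ • ∑ c,
        (fderiv ℝ ψ u (B c) - b c * fderiv ℝ ψ u (B (head c)))
          * (inner ℝ (B c) u • 1 + inner ℝ (B (head c)) u • b c) ∂μ
      = -((Module.finrank ℝ E * μ.real (ball 0 1)) • ψ 0) := by
  have heuler : Integrable (fun u => (‖u‖ ^ Module.finrank ℝ E)⁻¹ • fderiv ℝ ψ u u) μ :=
    integrable_inv_norm_pow_smul_fderiv μ hψ hc (.id ℝ E)
  have hrot (c : ι) := integrable_inv_norm_pow_smul_fderiv μ hψ hc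
    (infinitesimalRotation (B (head c)) (B c))
  have hrot_zero (c : ι) := integral_inv_norm_pow_smul_fderiv_eq_zero μ hψ hc
    (inner_infinitesimalRotation_self (B (head c)) (B c))
  simp only [sum_cauchyRiemann_mul_eq_euler_add_rotations B hb hsq, smul_add, Finset.smul_sum,
    ← mul_smul_comm]
  rw [integral_add heuler (integrable_finsetSum _ fun c _ => (hrot c).const_mul _),
    integral_finsetSum _ fun c _ => (hrot c).const_mul _]
  simp only [integral_const_mul_of_integrable (hrot _), hrot_zero, mul_zero,
    Finset.sum_const_zero, add_zero,
    integral_inv_norm_pow_smul_fderiv_self μ hψ hc]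

end CauchyRiemann

section Blocks

variable {q r : ℕ} (S : Blocks q r)

theorem Blocks.mem_block {t : Fin q} {k : Fin r} :
    t ∈ S.block k ↔ S.s k.castSucc ≤ t ∧ t < S.s k.succ := by
  simp [Blocks.block]

theorem Blocks.block_eq_insert (k : Fin r) : S.block k = insert (S.head k) (S.tail k) := by
  ext t
  have hlt : S.s k.castSucc < S.s k.succ := S.strictMono Fin.castSucc_lt_succ
  simp only [Blocks.block, Blocks.tail, Blocks.head, Finset.mem_filter, Finset.mem_univ,
    true_and, Finset.mem_insert, Fin.ext_iff]
  omega

theorem Blocks.head_mem_block (k : Fin r) : S.head k ∈ S.block k := by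
  simp [S.block_eq_insert]

theorem Blocks.head_notMem_tail (k : Fin r) : S.head k ∉ S.tail k := by
  simp [Blocks.tail, Blocks.head]

theorem Blocks.block_disjoint {k k' : Fin r} (hk : k < k') :
    Disjoint (S.block k) (S.block k') := by
  have hle : S.s k.succ ≤ S.s k'.castSucc :=
    S.strictMono.monotone (Fin.le_def.2 (by simpa using Nat.succ_le_of_lt (Fin.lt_def.1 hk)))
  refine Finset.disjoint_left.2 fun t h h' => ?_
  rw [S.mem_block] at h h'
  omega

theorem Blocks.exists_mem_block (t : Fin q) : ∃ k, t ∈ S.block k := by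
  have hlt (k : Fin (r + 1)) (hk : t < S.s k) : ∃ k', t ∈ S.block k' := by
    induction k using Fin.induction with
    | zero => exact absurd hk (by simp [S.first])
    | succ k ih =>
      rcases lt_or_ge (t : ℕ) (S.s k.castSucc) with h | h
      · exact ih h
      · exact ⟨k, S.mem_block.2 ⟨h, hk⟩⟩
  exact hlt (Fin.last r) (by simp [S.last])

/-- The index `k` of the block `{t | s_k ≤ t < s_{k+1}}` containing a given `t`. -/
def Blocks.blockIndex (t : Fin q) : Fin r := (S.exists_mem_block t).choose

theorem Blocks.mem_block_iff_blockIndex_eq {t : Fin q} {k : Fin r} :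
    t ∈ S.block k ↔ S.blockIndex t = k := by
  have hmem : t ∈ S.block (S.blockIndex t) := (S.exists_mem_block t).choose_spec
  refine ⟨fun h => ?_, fun h => h ▸ hmem⟩
  rcases lt_trichotomy (S.blockIndex t) k with hk | hk | hk
  · exact absurd h (Finset.disjoint_left.1 (S.block_disjoint hk) hmem)
  · exact hk
  · exact absurd hmem (Finset.disjoint_left.1 (S.block_disjoint hk) h)

theorem Blocks.blockIndex_head (k : Fin r) : S.blockIndex (S.head k) = k :=
  S.mem_block_iff_blockIndex_eq.1 (S.head_mem_block k)

theorem Blocks.sum_sum_block {M : Type*} [AddCommMonoid M] (f : Fin q → Fin r → M) :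
    ∑ k, ∑ t ∈ S.block k, f t k = ∑ t, f t (S.blockIndex t) := by
  rw [← Finset.sum_fiberwise Finset.univ S.blockIndex]
  refine Finset.sum_congr rfl fun k _ => ?_
  have hblock : S.block k = Finset.univ.filter fun t => S.blockIndex t = k := by
    ext t
    simp [S.mem_block_iff_blockIndex_eq]
  rw [hblock]
  exact Finset.sum_congr rfl fun t ht => by rw [(Finset.mem_filter.1 ht).2]

end Blocks

section Labels

variable {n m p q r : ℕ} (S : Blocks q r)

/-- The label of the coordinate which is paired with the one labelled `c` in the Cauchy–Riemann
operator: `y_i^0` for `y_i^j`, and `θ_l^{s_k}` for `θ_l^t` with `t` in the `k`-th block. -/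
def headLabel : Label n m p q → Label n m p q
  | .inl (i, _) => .inl (i, 0)
  | .inr (l, t) => .inr (l, S.head (S.blockIndex t))

theorem headLabel_headLabel (c : Label n m p q) :
    headLabel S (headLabel S c) = headLabel S c := by
  rcases c with ⟨i, j⟩ | ⟨l, t⟩
  · rfl
  · simp only [headLabel, S.blockIndex_head]

theorem sum_tail_eq_sum_label {M : Type*} [AddCommMonoid M]
    {F : Label n m p q → Label n m p q → M}
    (hF : ∀ c, F (headLabel S c) (headLabel S c) = 0) :
    ∑ i : Fin n, ∑ j : Fin p, F (.inl (i, j.succ)) (.inl (i, 0))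
      + ∑ l : Fin m, ∑ k : Fin r, ∑ t ∈ S.tail k, F (.inr (l, t)) (.inr (l, S.head k))
      = ∑ c, F c (headLabel S c) := by
  have hF_even (i : Fin n) : F (.inl (i, 0)) (.inl (i, 0)) = 0 := hF (.inl (i, 0))
  have hF_odd (l : Fin m) (k : Fin r) : F (.inr (l, S.head k)) (.inr (l, S.head k)) = 0 := by
    simpa only [headLabel, S.blockIndex_head] using hF (.inr (l, S.head k))
  have hblock (l : Fin m) (k : Fin r) :
      ∑ t ∈ S.tail k, F (.inr (l, t)) (.inr (l, S.head k))
        = ∑ t ∈ S.block k, F (.inr (l, t)) (.inr (l, S.head k)) := by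
    rw [S.block_eq_insert, Finset.sum_insert (S.head_notMem_tail k), hF_odd, zero_add]
  simp only [Fintype.sum_sum_type, Fintype.sum_prod_type, headLabel, Fin.sum_univ_succ (n := p),
    hF_even, zero_add, hblock]
  simp only [S.sum_sum_block fun t k => F (.inr (_, t)) (.inr (_, S.head k))]

variable {Λ : Type*} [NormedRing Λ] [NormedAlgebra ℝ Λ] {𝒜 : ZMod 2 → Submodule ℝ Λ}
  (e : Module.Basis (Fin (p + 1)) ℝ (𝒜 0)) (a : Fin q → 𝒜 0)

/-- The element `b` of `Λ₀` for which the Cauchy–Riemann operator contains the term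
`∂/∂x_c - b ∂/∂x_{c'}`, with `c' = headLabel S c`: `e_j` for `y_i^j`, and `a_t` for `θ_l^t`. -/
def headCoeff : Label n m p q → 𝒜 0
  | .inl (_, j) => e j
  | .inr (_, t) => a t

variable {e a}

theorem headCoeff_headLabel (he : 0 < n → (e 0 : Λ) = 1)
    (ha : 0 < m → ∀ k, (a (S.head k) : Λ) = 1) (c : Label n m p q) :
    (headCoeff e a (headLabel S c) : Λ) = 1 := by
  rcases c with ⟨i, _⟩ | ⟨l, _⟩
  · exact he i.pos
  · exact ha l.pos _

theorem sum_headCoeff_sq_eq_zero (he : 0 < n → ∑ j, (e j : Λ) ^ 2 = 0)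
    (ha : 0 < m → ∀ k, ∑ t ∈ S.block k, (a t : Λ) ^ 2 = 0) (h : Label n m p q) :
    ∑ c with headLabel S c = h, (headCoeff e a c : Λ) ^ 2 = 0 := by
  have heven (i : Fin n) : ∑ j, (if headLabel S (.inl (i, j) : Label n m p q) = h
      then (e j : Λ) ^ 2 else 0) = 0 := by
    by_cases hi : (.inl (i, 0) : Label n m p q) = h <;> simp [headLabel, hi, he i.pos]
  have hodd (l : Fin m) : ∑ t, (if headLabel S (.inr (l, t) : Label n m p q) = h
      then (a t : Λ) ^ 2 else 0) = 0 := by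
    refine (S.sum_sum_block fun t k => if (.inr (l, S.head k) : Label n m p q) = h
      then (a t : Λ) ^ 2 else 0).symm.trans (Finset.sum_eq_zero fun k _ => ?_)
    by_cases hk : (.inr (l, S.head k) : Label n m p q) = h <;> simp [hk, ha l.pos k]
  rw [Finset.sum_filter, Fintype.sum_sum_type, Fintype.sum_prod_type, Fintype.sum_prod_type]
  simp only [headCoeff, heven, hodd, Finset.sum_const_zero, add_zero]

end Labels

section Coordinates

variable {Λ : Type*} [NormedRing Λ] [NormedAlgebra ℝ Λ] {𝒜 : ZMod 2 → Submodule ℝ Λ}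
  {n m p q d : ℕ}

theorem position_inl (hd : n * (p + 1) + m * q = d + 1) (i : Fin n) (j : Fin (p + 1)) :
    (position hd (.inl (i, j) : Label n m p q) : ℕ) = (p + 1) * i + j := by
  simp [position, add_comm]

theorem position_inr (hd : n * (p + 1) + m * q = d + 1) (l : Fin m) (t : Fin q) :
    (position hd (.inr (l, t) : Label n m p q) : ℕ) = n * (p + 1) + t + q * l := by
  simp [position, add_assoc]

/-- The standard basis of the coordinate space, indexed by the labels of the coordinates. -/
def labelBasis (hd : n * (p + 1) + m * q = d + 1) :
    OrthonormalBasis (Label n m p q) ℝ (EuclideanSpace ℝ (Fin (d + 1))) :=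
  (EuclideanSpace.basisFun (Fin (d + 1)) ℝ).reindex (position hd).symm

theorem inner_labelBasis (hd : n * (p + 1) + m * q = d + 1) (c : Label n m p q)
    (u : EuclideanSpace ℝ (Fin (d + 1))) : inner ℝ (labelBasis hd c) u = u (position hd c) := by
  simp [labelBasis, EuclideanSpace.inner_single_left]

variable (e : Module.Basis (Fin (p + 1)) ℝ (𝒜 0)) (ε : Module.Basis (Fin q) ℝ (𝒜 1))
  (hd : n * (p + 1) + m * q = d + 1)

/-- The parametrization `point` of the superspace by its real coordinates, as a continuous linear
map. -/
def pointCLM : EuclideanSpace ℝ (Fin (d + 1)) →L[ℝ] Superspace 𝒜 n m :=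
  ∑ b, (EuclideanSpace.proj b : EuclideanSpace ℝ (Fin (d + 1)) →L[ℝ] ℝ).smulRight
    (coordVec e ε ((position hd).symm b))

theorem pointCLM_apply (u : EuclideanSpace ℝ (Fin (d + 1))) :
    pointCLM e ε hd u = point e ε hd u := by
  simp [pointCLM, point]

theorem pointCLM_labelBasis (c : Label n m p q) :
    pointCLM e ε hd (labelBasis hd c) = coordVec e ε c := by
  rw [pointCLM_apply, point, Finset.sum_eq_single (position hd c)]
  · simp [labelBasis]
  · intro b _ hb
    simp [labelBasis, hb]
  · simp

theorem fderiv_comp_pointCLM_labelBasis {F : Type*} [NormedAddCommGroup F] [NormedSpace ℝ F]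
    {φ : Superspace 𝒜 n m → F} {u : EuclideanSpace ℝ (Fin (d + 1))}
    (hφ : DifferentiableAt ℝ φ (point e ε hd u)) (c : Label n m p q) :
    fderiv ℝ (φ ∘ pointCLM e ε hd) u (labelBasis hd c)
      = fderiv ℝ φ (point e ε hd u) (coordVec e ε c) := by
  rw [← pointCLM_apply] at hφ ⊢
  have hchain := (HasFDerivAt.comp (𝕜 := ℝ) (E := EuclideanSpace ℝ (Fin (d + 1)))
    (F := Superspace 𝒜 n m) (G := F) u hφ.hasFDerivAt (pointCLM e ε hd).hasFDerivAt).fderiv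
  rw [hchain, ContinuousLinearMap.comp_apply, pointCLM_labelBasis]

variable [FiniteDimensional ℝ Λ]

theorem coord_coordVec (c c' : Label n m p q) :
    coord e ε c (coordVec e ε c') = if c = c' then 1 else 0 := by
  rcases c with ⟨i, j⟩ | ⟨l, t⟩ <;> rcases c' with ⟨i', j'⟩ | ⟨l', t'⟩
  · by_cases h : i = i'
    · subst h
      simp [coord, coordVec, Finsupp.single_apply, eq_comm]
    · simp [coord, coordVec, h]
  · simp [coord, coordVec]
  · simp [coord, coordVec]
  · by_cases h : l = l'
    · subst h
      simp [coord, coordVec, Finsupp.single_apply, eq_comm]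
    · simp [coord, coordVec, h]

theorem coord_point (c : Label n m p q) (u : EuclideanSpace ℝ (Fin (d + 1))) :
    coord e ε c (point e ε hd u) = u (position hd c) := by
  simp [point, coord_coordVec, Equiv.eq_symm_apply]

theorem euclNorm_point (u : EuclideanSpace ℝ (Fin (d + 1))) :
    euclNorm e ε (point e ε hd u) = ‖u‖ := by
  simp only [euclNorm, coord_point, EuclideanSpace.norm_eq, Real.norm_eq_abs, sq_abs]
  rw [(position hd).sum_comp fun b => u b ^ 2]

theorem isClosedEmbedding_pointCLM : IsClosedEmbedding (pointCLM e ε hd) := by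
  refine LinearMap.isClosedEmbedding_of_injective (f := (pointCLM e ε hd).toLinearMap)
    (LinearMap.ker_eq_bot.2 fun u v huv => ?_)
  ext b
  simpa [pointCLM_apply, coord_point] using congrArg (coord e ε ((position hd).symm b)) huv

end Coordinates

section GradedParity

theorem even_finrank_of_sum_sq_eq_zero_of_gradedMul {G Λ κ : Type*} [AddMonoid G] [Ring Λ]
    [Algebra ℝ Λ] (𝒜 : G → Submodule ℝ Λ) [SetLike.GradedMul 𝒜] (i : G)
    [FiniteDimensional ℝ (𝒜 i)] {a : κ → 𝒜 0} (ha : ∀ j k, Commute (a j : Λ) (a k))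
    {s : Finset κ} {k₀ : κ} (hk₀ : k₀ ∈ s) (hone : (a k₀ : Λ) = 1)
    (hsq : ∑ k ∈ s, (a k : Λ) ^ 2 = 0) : Even (Module.finrank ℝ (𝒜 i)) := by
  let T (k : κ) : Module.End ℝ (𝒜 i) := (LinearMap.mulLeft ℝ (a k : Λ)).restrict fun y hy => by
    simpa using SetLike.mul_mem_graded (a k).2 hy
  have hT (k : κ) (y : 𝒜 i) : (T k y : Λ) = a k * y := rfl
  refine even_finrank_of_sum_sq_eq_zero (T := T) (fun j k => ?_) hk₀ ?_ ?_
  · refine LinearMap.ext fun y => Subtype.ext ?_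
    simp only [Module.End.mul_apply, hT, ← mul_assoc, (ha j k).eq]
  · refine LinearMap.ext fun y => Subtype.ext ?_
    simp only [hT, hone, one_mul, Module.End.one_apply]
  · refine LinearMap.ext fun y => Subtype.ext ?_
    simp only [pow_two] at hsq ⊢
    simp [hT, ← mul_assoc, ← Finset.sum_mul, hsq]

theorem even_of_sum_block_sq_eq_zero {Λ : Type*} [Ring Λ] [Algebra ℝ Λ]
    {𝒜 : ZMod 2 → Submodule ℝ Λ} [SetLike.GradedMul 𝒜]
    {q r : ℕ} (ε : Module.Basis (Fin q) ℝ (𝒜 1)) (S : Blocks q r) {a : Fin q → 𝒜 0}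
    (ha : ∀ s t, Commute (a s : Λ) (a t)) (hhead : ∀ k, (a (S.head k) : Λ) = 1)
    (hsq : ∀ k, ∑ t ∈ S.block k, (a t : Λ) ^ 2 = 0) : Even q := by
  rcases q.eq_zero_or_pos with rfl | hq
  · exact Even.zero
  · have : FiniteDimensional ℝ (𝒜 1) := ε.finiteDimensional_of_finite
    let k := S.blockIndex ⟨0, hq⟩
    simpa [Module.finrank_eq_card_basis ε] using even_finrank_of_sum_sq_eq_zero_of_gradedMul 𝒜 1
      ha (S.head_mem_block k) (hhead k) (hsq k)

theorem IsSupercommutative.commute_of_even {Λ : Type*} [Ring Λ] [Algebra ℝ Λ]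
    {𝒜 : ZMod 2 → Submodule ℝ Λ} [DirectSum.Decomposition 𝒜] (hsc : IsSupercommutative 𝒜)
    (x : 𝒜 0) (y : Λ) : Commute (x : Λ) y := by
  have hhom (i : ZMod 2) (z : 𝒜 i) : Commute (x : Λ) z := by
    simpa [commute_iff_eq] using hsc 0 i x x.2 z z.2
  induction y using DirectSum.Decomposition.inductionOn 𝒜 with
  | zero => exact Commute.zero_right _
  | homogeneous z => exact hhom _ z
  | add y z hy hz => exact hy.add_right hz

end GradedParity

section Forms

variable {Λ : Type*} [NormedRing Λ] [NormedAlgebra ℝ Λ] [FiniteDimensional ℝ Λ]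
  {𝒜 : ZMod 2 → Submodule ℝ Λ} {n m p q r d : ℕ}

theorem wedgeOne_apply {k : ℕ} (l : Superspace 𝒜 n m →L[ℝ] Λ) (ω : ExtForm 𝒜 n m k)
    (v : Fin (k + 1) → Superspace 𝒜 n m) :
    wedgeOne l ω v = ∑ i : Fin (k + 1), (-1 : ℝ) ^ (i : ℕ) • (l (v i) * ω (i.removeNth v)) := by
  rw [wedgeOne, ContinuousAlternatingMap.alternatizeUncurryFin_apply]
  refine Finset.sum_congr rfl fun i _ => ?_
  rw [← Int.cast_smul_eq_zsmul ℝ]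
  push_cast
  rfl

variable (e : Module.Basis (Fin (p + 1)) ℝ (𝒜 0)) (ε : Module.Basis (Fin q) ℝ (𝒜 1))
  (hd : n * (p + 1) + m * q = d + 1)

/-- The coefficient of `l ∧ ω` in front of the orientation form `dV`, as a function of `ω`. -/
def wedgeCoeff (l : Superspace 𝒜 n m →L[ℝ] Λ) : ExtForm 𝒜 n m d →ₗ[ℝ] Λ where
  toFun ω := wedgeOne l ω fun b => coordVec e ε ((position hd).symm b)
  map_add' ω η := by simp [wedgeOne_apply, mul_add, Finset.sum_add_distrib]
  map_smul' c ω := by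
    simp [wedgeOne_apply, Finset.smul_sum, smul_comm c]

theorem hatForm_removeNth_coordVec (c : Label n m p q) (i : Fin (d + 1)) :
    hatForm e ε hd c (i.removeNth fun b => coordVec e ε ((position hd).symm b))
      = if i = position hd c then 1 else 0 := by
  have hdet : hatForm e ε hd c (i.removeNth fun b => coordVec e ε ((position hd).symm b))
      = algebraMap ℝ Λ (Matrix.det (Matrix.of fun b b' : Fin d =>
          if (position hd c).succAbove b' = i.succAbove b then (1 : ℝ) else 0)) := by
    change algebraMap ℝ Λ (Matrix.det (Matrix.of fun b b' : Fin d =>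
      coord e ε ((position hd).symm ((position hd c).succAbove b'))
        (coordVec e ε ((position hd).symm (i.succAbove b))))) = _
    simp only [coord_coordVec, EmbeddingLike.apply_eq_iff_eq]
  rw [hdet]
  split_ifs with hi
  · subst hi
    convert map_one (algebraMap ℝ Λ)
    convert Matrix.det_one (R := ℝ) (n := Fin d) using 2
    ext b b'
    simp [Matrix.one_apply, eq_comm]
  · obtain ⟨b, hb⟩ := Fin.exists_succAbove_eq (x := position hd c) (y := i) (Ne.symm hi)
    rw [Matrix.det_eq_zero_of_row_eq_zero b (by simp [hb, Fin.succAbove_ne]), map_zero]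

theorem wedgeCoeff_smul_hatForm (l : Superspace 𝒜 n m →L[ℝ] Λ) (h : Λ) (c : Label n m p q) :
    wedgeCoeff e ε hd l (h • hatForm e ε hd c)
      = (-1 : ℝ) ^ (position hd c : ℕ) • (l (coordVec e ε c) * h) := by
  change wedgeOne l (h • hatForm e ε hd c) _ = _
  simp only [wedgeOne_apply, ContinuousAlternatingMap.smul_apply, hatForm_removeNth_coordVec]
  rw [Finset.sum_eq_single (position hd c)]
  · simp
  · intro b _ hb
    simp [hb]
  · simp

theorem wedgeOne_dcoord_coordVec (c c' : Label n m p q) (ω : ExtForm 𝒜 n m 0) :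
    wedgeOne (dcoord e ε c) ω (fun _ => coordVec e ε c') = if c = c' then ω 0 else 0 := by
  have hω (v : Fin 0 → Superspace 𝒜 n m) : ω v = ω 0 := by rw [Subsingleton.elim v 0]
  by_cases h : c = c' <;> simp [wedgeOne_apply, dcoord, coord_coordVec, h, hω]

theorem partialForm_zeroForm {φ : Superspace 𝒜 n m → Λ} {x : Superspace 𝒜 n m}
    (hφ : DifferentiableAt ℝ φ x) (c : Label n m p q) :
    partialForm e ε c (zeroForm φ) x = zeroForm (fun x => fderiv ℝ φ x (coordVec e ε c)) x := by
  let toForm : Λ →L[ℝ] ExtForm 𝒜 n m 0 := LinearMap.toContinuousLinearMap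
    { toFun := ContinuousAlternatingMap.constOfIsEmpty ℝ (Superspace 𝒜 n m) (Fin 0)
      map_add' := fun _ _ => rfl
      map_smul' := fun _ _ => rfl }
  have h : fderiv ℝ (zeroForm φ) x = toForm.comp (fderiv ℝ φ x) :=
    (HasFDerivAt.comp (𝕜 := ℝ) (E := Superspace 𝒜 n m) (F := Λ) (G := ExtForm 𝒜 n m 0) x
      toForm.hasFDerivAt hφ.hasFDerivAt).fderiv
  rw [partialForm, h]
  rfl

variable {e} (S : Blocks q r) {a : Fin q → 𝒜 0}

theorem dbar_eq_sum_label {k : ℕ}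
    (hone : ∀ c : Label n m p q, (headCoeff e a (headLabel S c) : Λ) = 1)
    (ω : Superspace 𝒜 n m → ExtForm 𝒜 n m k) (x : Superspace 𝒜 n m) :
    dbar e ε S a ω x = ∑ c, wedgeOne (dcoord e ε c) (partialForm e ε c ω x
      - (headCoeff e a c : Λ) • partialForm e ε (headLabel S c) ω x) := by
  refine sum_tail_eq_sum_label S (F := fun c c' => wedgeOne (dcoord e ε c)
    (partialForm e ε c ω x - (headCoeff e a c : Λ) • partialForm e ε c' ω x)) fun c => ?_
  simp only [hone, one_smul, sub_self]
  ext v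
  simp [wedgeOne_apply]

theorem dbar_zeroForm_coordVec
    (hone : ∀ c : Label n m p q, (headCoeff e a (headLabel S c) : Λ) = 1)
    {φ : Superspace 𝒜 n m → Λ} {x : Superspace 𝒜 n m} (hφ : DifferentiableAt ℝ φ x)
    (c : Label n m p q) :
    dbar e ε S a (zeroForm φ) x (fun _ => coordVec e ε c)
      = fderiv ℝ φ x (coordVec e ε c)
        - (headCoeff e a c : Λ) * fderiv ℝ φ x (coordVec e ε (headLabel S c)) := by
  rw [dbar_eq_sum_label ε S hone, ContinuousAlternatingMap.sum_apply, Finset.sum_eq_single c]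
  · simp [wedgeOne_dcoord_coordVec, partialForm_zeroForm e ε hφ, zeroForm]
  · intro c' _ hc
    simp [wedgeOne_dcoord_coordVec, hc]
  · simp

end Forms

section FundamentalForm

variable {Λ : Type*} [NormedRing Λ] [NormedAlgebra ℝ Λ] [FiniteDimensional ℝ Λ]
  {𝒜 : ZMod 2 → Submodule ℝ Λ} {n m p q r d : ℕ} {e : Module.Basis (Fin (p + 1)) ℝ (𝒜 0)}
  {ε : Module.Basis (Fin q) ℝ (𝒜 1)} {S : Blocks q r} {a : Fin q → 𝒜 0}
  (hd : n * (p + 1) + m * q = d + 1)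

theorem fundConst_mul_neg_finrank_mul_measure_ball (hd : n * (p + 1) + m * q = d + 1) :
    fundConst n m p q d * -(Module.finrank ℝ (EuclideanSpace ℝ (Fin (d + 1))) *
      volume.real (ball (0 : EuclideanSpace ℝ (Fin (d + 1))) 1)) = 1 := by
  have hvol : 0 < volume.real (ball (0 : EuclideanSpace ℝ (Fin (d + 1))) 1) :=
    ENNReal.toReal_pos (measure_ball_pos _ _ one_pos).ne' measure_ball_lt_top.ne
  rw [finrank_euclideanSpace_fin, fundConst, mul_comm q m, hd, neg_mul_neg]
  exact inv_mul_cancel₀ (by positivity)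

theorem fundConst_div_euclNorm_point_pow (u : EuclideanSpace ℝ (Fin (d + 1))) :
    fundConst n m p q d / euclNorm e ε (point e ε hd u) ^ (n * (p + 1) + q * m)
      = fundConst n m p q d * (‖u‖ ^ Module.finrank ℝ (EuclideanSpace ℝ (Fin (d + 1))))⁻¹ := by
  rw [euclNorm_point, finrank_euclideanSpace_fin, mul_comm q m, hd, div_eq_mul_inv]

variable (e ε S a) in
theorem exists_clm_fundForm_eq : ∃ A : Superspace 𝒜 n m →L[ℝ] ExtForm 𝒜 n m d, ∀ x,
    fundForm e ε S a hd x
      = (fundConst n m p q d / euclNorm e ε x ^ (n * (p + 1) + q * m)) • A x := by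
  let A : Superspace 𝒜 n m →L[ℝ] ExtForm 𝒜 n m d :=
    (∑ i : Fin n, ∑ j : Fin p, (-1 : ℝ) ^ ((p + 1) * (i : ℕ) + (j.succ : ℕ)) •
      ((coord e ε (.inl (i, j.succ))).smulRight (hatForm e ε hd (.inl (i, j.succ)))
        + (coord e ε (.inl (i, 0))).smulRight
            ((e j.succ : Λ) • hatForm e ε hd (.inl (i, j.succ)))))
    + ∑ l : Fin m, ∑ k : Fin r, ∑ t ∈ S.tail k, (-1 : ℝ) ^ (n * (p + 1) + (t : ℕ)) •
      ((coord e ε (.inr (l, t))).smulRight (hatForm e ε hd (.inr (l, t)))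
        + (coord e ε (.inr (l, S.head k))).smulRight
            ((a t : Λ) • hatForm e ε hd (.inr (l, t))))
  have hsplit (s t : ℝ) (b : Λ) (ω : ExtForm 𝒜 n m d) :
      (s • (1 : Λ) + t • b) • ω = s • ω + t • b • ω := by
    ext v
    simp [add_mul]
  refine ⟨A, fun x => ?_⟩
  simp [A, fundForm, hsplit]

theorem locallyIntegrable_fundForm (v : Fin d → Superspace 𝒜 n m) :
    LocallyIntegrable fun u : EuclideanSpace ℝ (Fin (d + 1)) =>
      fundForm e ε S a hd (point e ε hd u) v := by
  obtain ⟨A, hA⟩ := exists_clm_fundForm_eq e ε S a hd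
  have hlinear := locallyIntegrable_inv_norm_pow_smul_clm
    (volume : Measure (EuclideanSpace ℝ (Fin (d + 1))))
    ((ContinuousAlternatingMap.apply ℝ (Superspace 𝒜 n m) Λ v).comp (A.comp (pointCLM e ε hd)))
  refine (hlinear.smul (fundConst n m p q d)).congr (ae_of_all _ fun u => ?_)
  simp [hA, fundConst_div_euclNorm_point_pow, mul_smul, pointCLM_apply]

theorem wedgeCoeff_fundForm (hq : 0 < m → Even q) {l : Superspace 𝒜 n m →L[ℝ] Λ}
    (hl : ∀ c, l (coordVec e ε (headLabel S c)) = 0) (x : Superspace 𝒜 n m) :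
    wedgeCoeff e ε hd l (fundForm e ε S a hd x)
      = (fundConst n m p q d / euclNorm e ε x ^ (n * (p + 1) + q * m)) • ∑ c,
        l (coordVec e ε c)
          * (coord e ε c x • 1 + coord e ε (headLabel S c) x • (headCoeff e a c : Λ)) := by
  have hsign (s : ℕ) (y : Λ) : (-1 : ℝ) ^ s • (-1 : ℝ) ^ s • y = y := by
    rw [smul_smul, ← mul_pow, neg_one_mul, neg_neg, one_pow, one_smul]
  have hsign_odd (l : Fin m) (t : Fin q) (y : Λ) : (-1 : ℝ) ^ (n * (p + 1) + (t : ℕ)) •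
      (-1 : ℝ) ^ (n * (p + 1) + (t : ℕ) + q * (l : ℕ)) • y = y := by
    rw [pow_add _ _ (q * (l : ℕ)), ((hq l.pos).mul_right l).neg_one_pow, mul_one, hsign]
  rw [← sum_tail_eq_sum_label S (F := fun c c' => l (coordVec e ε c)
    * (coord e ε c x • 1 + coord e ε c' x • (headCoeff e a c : Λ))) (by simp [hl])]
  simp only [fundForm, map_smul, map_add, map_sum, wedgeCoeff_smul_hatForm, position_inl,
    position_inr, hsign, hsign_odd, headCoeff]

theorem wedgeCoeff_dbar_fundForm (hq : 0 < m → Even q)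
    (hone : ∀ c : Label n m p q, (headCoeff e a (headLabel S c) : Λ) = 1)
    {φ : Superspace 𝒜 n m → Λ} (hφ : Differentiable ℝ φ) (u : EuclideanSpace ℝ (Fin (d + 1))) :
    wedgeCoeff e ε hd
        ((ContinuousAlternatingMap.ofSubsingleton ℝ (Superspace 𝒜 n m) Λ (0 : Fin 1)).symm
          (dbar e ε S a (zeroForm φ) (point e ε hd u)))
        (fundForm e ε S a hd (point e ε hd u))
      = fundConst n m p q d • (‖u‖ ^ Module.finrank ℝ (EuclideanSpace ℝ (Fin (d + 1))))⁻¹ •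
        ∑ c, (fderiv ℝ (φ ∘ pointCLM e ε hd) u (labelBasis hd c) - (headCoeff e a c : Λ) *
            fderiv ℝ (φ ∘ pointCLM e ε hd) u (labelBasis hd (headLabel S c)))
          * (inner ℝ (labelBasis hd c) u • 1
            + inner ℝ (labelBasis hd (headLabel S c)) u • (headCoeff e a c : Λ)) := by
  set l := (ContinuousAlternatingMap.ofSubsingleton ℝ (Superspace 𝒜 n m) Λ (0 : Fin 1)).symm
    (dbar e ε S a (zeroForm φ) (point e ε hd u))
  have hl (c : Label n m p q) : l (coordVec e ε c) = fderiv ℝ φ (point e ε hd u) (coordVec e ε c)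
      - (headCoeff e a c : Λ) *
        fderiv ℝ φ (point e ε hd u) (coordVec e ε (headLabel S c)) :=
    dbar_zeroForm_coordVec ε S hone (hφ _) c
  have hl_head (c : Label n m p q) : l (coordVec e ε (headLabel S c)) = 0 := by
    rw [hl, headLabel_headLabel, hone, one_mul, sub_self]
  simp only [wedgeCoeff_fundForm hd hq hl_head, hl, fundConst_div_euclNorm_point_pow, mul_smul,
    fderiv_comp_pointCLM_labelBasis e ε hd (hφ _), coord_point, inner_labelBasis]

theorem dbarCurrent_currentOf_fundForm (hq : 0 < m → Even q)
    (hcentral : ∀ (x : 𝒜 0) (y : Λ), Commute (x : Λ) y)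
    (hone : ∀ c : Label n m p q, (headCoeff e a (headLabel S c) : Λ) = 1)
    (hsq : ∀ h : Label n m p q, ∑ c with headLabel S c = h, (headCoeff e a c : Λ) ^ 2 = 0)
    {φ : Superspace 𝒜 n m → Λ} (hφ : ContDiff ℝ 1 φ) (hc : HasCompactSupport φ) :
    dbarCurrent e ε S a (currentOf e ε hd (fundForm e ε S a hd)) φ = evalCurrent φ := by
  have : CompleteSpace Λ := FiniteDimensional.complete ℝ Λ
  have hψ : ContDiff ℝ 1 (φ ∘ pointCLM e ε hd) :=
    ContDiff.comp (𝕜 := ℝ) (E := EuclideanSpace ℝ (Fin (d + 1))) (F := Superspace 𝒜 n m) hφ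
      (ContinuousLinearMap.contDiff _)
  calc dbarCurrent e ε S a (currentOf e ε hd (fundForm e ε S a hd)) φ
      = fundConst n m p q d • ∫ u, (‖u‖ ^ Module.finrank ℝ (EuclideanSpace ℝ (Fin (d + 1))))⁻¹ •
        ∑ c, (fderiv ℝ (φ ∘ pointCLM e ε hd) u (labelBasis hd c) - (headCoeff e a c : Λ) *
            fderiv ℝ (φ ∘ pointCLM e ε hd) u (labelBasis hd (headLabel S c)))
          * (inner ℝ (labelBasis hd c) u • 1
            + inner ℝ (labelBasis hd (headLabel S c)) u • (headCoeff e a c : Λ)) := by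
        rw [← integral_smul]
        exact integral_congr_ae (ae_of_all _ fun u =>
          wedgeCoeff_dbar_fundForm hd hq hone (hφ.differentiable one_ne_zero) u)
    _ = φ 0 := by
        rw [integral_inv_norm_pow_smul_sum_cauchyRiemann volume (labelBasis hd)
          (fun c => hcentral (headCoeff e a c)) hsq hψ
          (hc.comp_isClosedEmbedding (isClosedEmbedding_pointCLM e ε hd)), ← neg_smul, smul_smul,
          fundConst_mul_neg_finrank_mul_measure_ball hd, one_smul, Function.comp_apply, map_zero]

end FundamentalForm

end Superanalysis

end

theorem mainTheorem2_general {Λ : Type*} [NormedRing Λ] [NormedAlgebra ℝ Λ]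
    [FiniteDimensional ℝ Λ] (𝒜 : ZMod 2 → Submodule ℝ Λ) [SetLike.GradedMul 𝒜]
    (hcentral : ∀ (x : 𝒜 0) (y : Λ), Commute (x : Λ) y)
    {n m p q r d : ℕ} (hd : n * (p + 1) + m * q = d + 1)
    (e : Module.Basis (Fin (p + 1)) ℝ (𝒜 0)) (hA0 : 0 < n → Superanalysis.ConditionA0 e)
    (ε : Module.Basis (Fin q) ℝ (𝒜 1)) (S : Superanalysis.Blocks q r) (a : Fin q → 𝒜 0)
    (hhead : 0 < m → ∀ k, (a (S.head k) : Λ) = 1)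
    (hsq : 0 < m → ∀ k, ∑ t ∈ S.block k, (a t : Λ) ^ 2 = 0) :
    Superanalysis.IsFundamentalSolution e ε S a hd
      (Superanalysis.fundForm (n := n) (m := m) e ε S a hd) where
  locallyIntegrable := Superanalysis.locallyIntegrable_fundForm hd
  dbar_eq _ hφ hc := Superanalysis.dbarCurrent_currentOf_fundForm hd
    (fun hm => Superanalysis.even_of_sum_block_sq_eq_zero ε S (fun s _ => hcentral (a s) _)
      (hhead hm) (hsq hm))
    hcentral
    (Superanalysis.headCoeff_headLabel S (fun hn => (hA0 hn).1) hhead)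
    (Superanalysis.sum_headCoeff_sq_eq_zero S (fun hn => (hA0 hn).2) hsq)
    (hφ.of_le (by exact_mod_cast le_top)) hc

theorem mainTheorem2 {Λ : Type*} [NormedRing Λ] [NormedAlgebra ℝ Λ] [FiniteDimensional ℝ Λ]
    (𝒜 : ZMod 2 → Submodule ℝ Λ) [GradedAlgebra 𝒜]
    (hsc : Superanalysis.IsSupercommutative 𝒜)
    {n m p q r d : ℕ} (hd : n * (p + 1) + m * q = d + 1)
    (e : Module.Basis (Fin (p + 1)) ℝ (𝒜 0)) (hA0 : Superanalysis.ConditionA0 e)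
    (ε : Module.Basis (Fin q) ℝ (𝒜 1)) (S : Superanalysis.Blocks q r) (a : Fin q → 𝒜 0)
    (hA1 : 0 < m → Superanalysis.ConditionA1 ε S a) :
    Superanalysis.IsFundamentalSolution e ε S a hd
      (Superanalysis.fundForm (n := n) (m := m) e ε S a hd) :=
  mainTheorem2_general 𝒜 hsc.commute_of_even hd e (fun _ => hA0) ε S a
    (fun hm => (hA1 hm).head_eq_one) fun hm => (hA1 hm).sum_sq
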